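/- Let $q = p^h$, where $p$ is a prime and $q$ is not a prime, and let $k$ be an integer with $q-2p+4 \leq k \leq q$. Let $S$ be a set of vectors of $\mathbb{F}_q^k$ in which every subset of $S$ of size $k$ is a basis of $\mathbb{F}_q^k$. Then $|S| \leq q+1$. -/

import Mathlib

/-- Every subset of `S` with exactly `k` elements is a basis of `V`
(linearly independent and spanning). -/
def EverySubsetIsBasis (K : Type*) {V : Type*} [Field K] [AddCommGroup V] [Module K V]
    (k : ℕ) (S : Finset V) : Prop :=
  ∀ B : Finset V, B ⊆ S → B.card = k →
    LinearIndependent K (fun v : B => (v : V)) ∧ Submodule.span K (B : Set V) = ⊤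

/-! A counterexample has a subset of size q + 2 which dualises to an arc in dimension r + 2, where r
= q - k ≤ 2p - 4. Each (r + 1)-subset C of points spans a hyperplane with functional l_C. For a set
E of 2r + 1 points, weight each C ⊆ E by the inverse of the product of l_C over the points off C,
those in E counted twice. Projecting from r points to a line and interpolating shows that these
weights are a null vector of an inclusion matrix (`isInclusionNull_arcWeight`).

Write r = m + d with m ≤ d and d + 1 < p. Differencing along m pairs {a_j, b_j} leaves a null vector
on 2d + 1 points, which vanishes in this characteristic; so an alternating sum of weights over
transversals is zero (`IsInclusionNull.sum_transversal_eq_zero`). Deleting m further points Z from a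
larger E multiplies each weight by the product of l_C over Z. Letting Z vary and polarizing
(`sum_mul_prod_eq_zero_of_distinct`), the points of Z may be replaced by any m vectors. At b_1, ...,
b_m a single nonzero term survives, a contradiction. -/

open Finset

/-! ### Null vectors of inclusion matrices -/

section Inclusion

variable {F ι κ : Type*} [Field F] [DecidableEq ι] [DecidableEq κ]

/-- `f` lies in the kernel of the inclusion matrix of `r`-subsets versus `(r + 1)`-subsets
of `E`. -/
def IsInclusionNull (f : Finset ι → F) (E : Finset ι) (r : ℕ) : Prop :=
  ∀ A ⊆ E, #A = r → ∑ x ∈ E \ A, f (insert x A) = 0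

/-- Nullity at A ∪ {a} and at A ∪ {b} gives both sums the same value, minus f at A ∪ {a, b}. -/
theorem IsInclusionNull.sub {f : Finset ι → F} {E : Finset ι} {r : ℕ}
    (hf : IsInclusionNull f E (r + 1)) {a b : ι} (ha : a ∈ E) (hb : b ∈ E) (hab : a ≠ b) :
    IsInclusionNull (fun X => f (insert a X) - f (insert b X)) ((E.erase a).erase b) r := by
  intro A hA hr
  have haA : a ∉ A := fun h => by simpa using hA h
  have hbA : b ∉ A := fun h => by simpa using hA h
  have hAE : A ⊆ E := fun x hx => mem_of_mem_erase (mem_of_mem_erase (hA hx))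
  have key : ∀ c d, c ∈ E → d ∈ E → c ≠ d → c ∉ A → d ∉ A →
      ∑ x ∈ ((E.erase c).erase d) \ A, f (insert c (insert x A)) = - f (insert c (insert d A)) := by
    intro c d hc hd hcd hcA hdA
    have h := hf (insert c A) (insert_subset hc hAE) (by rw [card_insert_of_notMem hcA, hr])
    have hs : E \ insert c A = insert d (((E.erase c).erase d) \ A) := by
      ext x
      simp only [mem_sdiff, mem_insert, mem_erase]
      by_cases hxd : x = d
      · subst hxd; simp [hd, hdA, hcd.symm]
      · tauto
    rw [hs, sum_insert (by simp)] at h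
    rw [insert_comm c d, eq_neg_iff_add_eq_zero, add_comm, ← h]
    congr 1
    exact sum_congr rfl fun x _ => by rw [insert_comm]
  rw [sum_sub_distrib, key a b ha hb hab haA hbA, erase_right_comm,
    key b a hb ha hab.symm hbA haA, insert_comm a b, sub_self]

/-- By induction the differences vanish, so exchanging one element of X does not change f; a null
relation then reads (d + 1) f(X) = 0. -/
theorem IsInclusionNull.eq_zero {d : ℕ} {E : Finset ι} {f : Finset ι → F}
    (hf : IsInclusionNull f E d) (hE : #E = 2 * d + 1)
    (hd : ∀ i ≤ d, ((i + 1 : ℕ) : F) ≠ 0) {X : Finset ι} (hX : X ⊆ E) (hXc : #X = d + 1) :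
    f X = 0 := by
  induction d generalizing E f X with
  | zero =>
    have : X = E := eq_of_subset_of_card_le hX (by omega)
    obtain ⟨x, rfl⟩ := card_eq_one.1 hXc
    subst this
    simpa using hf ∅ (by simp) (by simp)
  | succ d ih =>
    obtain ⟨x₀, hx₀⟩ : X.Nonempty := card_pos.1 (by omega)
    have hAc : #(X.erase x₀) = d + 1 := by rw [card_erase_of_mem hx₀]; omega
    have hAE : X.erase x₀ ⊆ E := (erase_subset _ _).trans hX
    have h := hf _ hAE hAc
    have hconst : ∀ x ∈ E \ X.erase x₀, f (insert x (X.erase x₀)) = f X := by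
      intro x hx
      rw [mem_sdiff] at hx
      by_cases hxx : x = x₀
      · rw [hxx, insert_erase hx₀]
      have hE' : #((E.erase x).erase x₀) = 2 * d + 1 := by
        rw [card_erase_of_mem (mem_erase.2 ⟨Ne.symm hxx, hX hx₀⟩), card_erase_of_mem hx.1]
        omega
      have := ih (hf.sub hx.1 (hX hx₀) hxx) hE' (fun i hi => hd i (by omega))
        (X := X.erase x₀) (fun y hy => mem_erase.2 ⟨(mem_erase.1 hy).1,
          mem_erase.2 ⟨fun h => hx.2 (h ▸ hy), hAE hy⟩⟩) hAc
      rw [sub_eq_zero] at this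
      rw [this, insert_erase hx₀]
    rw [sum_congr rfl hconst, sum_const, card_sdiff_of_subset hAE, hAc, nsmul_eq_mul,
      show #E - (d + 1) = d + 1 + 1 by omega] at h
    exact (mul_eq_zero.1 h).resolve_left (hd (d + 1) le_rfl)

theorem IsInclusionNull.sum_transversal_eq_zero {d : ℕ} {a b : κ → ι}
    (ha : a.Injective) (hb : b.Injective) (hab : ∀ i j, a i ≠ b j)
    (hd : ∀ i ≤ d, ((i + 1 : ℕ) : F) ≠ 0) (J : Finset κ) {E : Finset ι} {f : Finset ι → F}
    (hf : IsInclusionNull f E (#J + d)) (hE : #E = 2 * #J + 2 * d + 1)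
    (haE : ∀ j ∈ J, a j ∈ E) (hbE : ∀ j ∈ J, b j ∈ E)
    {X : Finset ι} (hX : X ⊆ E) (hXc : #X = d + 1)
    (haX : ∀ j ∈ J, a j ∉ X) (hbX : ∀ j ∈ J, b j ∉ X) :
    ∑ T ∈ J.powerset, (-1) ^ #T * f ((J \ T).image a ∪ T.image b ∪ X) = 0 := by
  induction J using Finset.induction_on generalizing E f with
  | empty => 
    simp only [card_empty, zero_add, mul_zero] at hf hE
    simpa using hf.eq_zero hE hd hX hXc
  | insert j J hj ih =>
    rw [card_insert_of_notMem hj] at hf hE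
    have haj := haE j (mem_insert_self _ _)
    have hbj := hbE j (mem_insert_self _ _)
    have hf' := IsInclusionNull.sub (r := #J + d) (by convert hf using 1; omega) haj hbj (hab j j)
    have := ih hf' (by
        rw [card_erase_of_mem (mem_erase.2 ⟨(hab j j).symm, hbj⟩), card_erase_of_mem haj]
        omega)
      (fun i hi => mem_erase.2 ⟨hab _ _, mem_erase.2 ⟨fun h => hj (ha h ▸ hi),
        haE i (mem_insert_of_mem hi)⟩⟩)
      (fun i hi => mem_erase.2 ⟨fun h => hj (hb h ▸ hi), mem_erase.2 ⟨(hab _ _).symm,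
        hbE i (mem_insert_of_mem hi)⟩⟩)
      (fun x hx => mem_erase.2 ⟨fun h => hbX j (mem_insert_self _ _) (h ▸ hx),
        mem_erase.2 ⟨fun h => haX j (mem_insert_self _ _) (h ▸ hx), hX hx⟩⟩)
      (fun i hi => haX i (mem_insert_of_mem hi)) (fun i hi => hbX i (mem_insert_of_mem hi))
    rw [sum_powerset_insert hj, ← sum_add_distrib, ← this]
    refine sum_congr rfl fun T hT => ?_
    have hjT : j ∉ T := fun h => hj (mem_powerset.1 hT h)
    rw [card_insert_of_notMem hjT, insert_sdiff_of_notMem _ hjT, image_insert, image_insert,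
      insert_sdiff_insert, sdiff_insert_of_notMem hj, insert_union, insert_union, union_insert,
      insert_union]
    ring

end Inclusion

/-! ### Lagrange interpolation over a finite field -/

section Interpolation

variable {F ι : Type*} [Field F] [DecidableEq ι]

open Polynomial in
theorem sum_eval_mul_prod_inv_eq_zero {E : Finset ι} {x : ι → F} (hx : Set.InjOn x E)
    {P : F[X]} (hP : P.natDegree + 2 ≤ #E) :
    ∑ a ∈ E, P.eval (x a) * (∏ z ∈ E.erase a, (x a - x z))⁻¹ = 0 := by
  have hlt : P.degree < #E :=
    degree_le_natDegree.trans_lt (by exact_mod_cast (by omega : P.natDegree < #E))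
  have h := Lagrange.coeff_eq_sum (P := P) hx hlt
  rw [coeff_eq_zero_of_natDegree_lt (by omega)] at h
  simpa [div_eq_mul_inv] using h.symm

variable [Fintype F] [DecidableEq F]

theorem prod_erase_sub_eq (x : F) :
    ∏ c ∈ univ.erase x, (x - c) = ∏ c ∈ univ.erase (0 : F), c := by
  refine prod_bij (fun c _ => x - c) ?_ ?_ ?_ ?_
  · intro c hc; simpa [sub_eq_zero, eq_comm] using hc
  · intro c _ d _ h; simpa using h
  · intro c hc; exact ⟨x - c, by simpa using hc, by simp⟩
  · simp

theorem prod_univ_erase_zero_ne_zero : ∏ c ∈ univ.erase (0 : F), c ≠ 0 :=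
  prod_ne_zero_iff.2 fun _ hc => ne_of_mem_erase hc

open Polynomial in
/-- The affine form of the identity satisfied by the points of an arc on a line. -/
theorem sum_prod_inv_mul_prod_inv_eq_zero {E R : Finset ι} (hER : E ⊆ R) {x : ι → F}
    (hx : Set.InjOn x R) (hcard : #E + #R = Fintype.card F + 2) :
    ∑ a ∈ E, (∏ z ∈ R.erase a, (x a - x z))⁻¹ * (∏ z ∈ E.erase a, (x a - x z))⁻¹ = 0 := by
  -- P has degree q - #R = #E - 2, just low enough for interpolation on E. At x a, it completes the
  -- product over R to the product of all nonzero field elements.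
  set P : F[X] := ∏ c ∈ univ \ R.image x, (X - C c) with hPdef
  have hRc : #(R.image x) = #R := card_image_of_injOn hx
  have hRle : #R ≤ Fintype.card F := hRc ▸ card_le_univ _
  have hdeg : P.natDegree = Fintype.card F - #R := by
    rw [hPdef, natDegree_prod_of_monic _ _ fun c _ => monic_X_sub_C c]
    simp [card_sdiff_of_subset (subset_univ _), hRc]
  have h := sum_eval_mul_prod_inv_eq_zero (hx.mono hER) (P := P) (by omega)
  set κ : F := ∏ c ∈ univ.erase (0 : F), c with hκ
  have hκ0 : κ ≠ 0 := prod_univ_erase_zero_ne_zero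
  have hev : ∀ a ∈ E, P.eval (x a) = κ * (∏ z ∈ R.erase a, (x a - x z))⁻¹ := by
    intro a ha
    have haR := hER ha
    have hne : ∏ z ∈ R.erase a, (x a - x z) ≠ 0 := prod_ne_zero_iff.2 fun z hz => by
      rw [sub_ne_zero]
      exact fun h => (mem_erase.1 hz).1 (hx haR (mem_erase.1 hz).2 h).symm
    rw [eq_mul_inv_iff_mul_eq₀ hne, hκ, ← prod_erase_sub_eq (x a), hPdef, eval_prod]
    have him : ∏ z ∈ R.erase a, (x a - x z) = ∏ c ∈ (R.image x).erase (x a), (x a - c) := by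
      rw [← prod_image (g := x) (f := fun c => x a - c)
        (hx.mono (by exact_mod_cast erase_subset a R))]
      congr 1
      ext c
      simp only [mem_image, mem_erase]
      constructor
      · rintro ⟨z, ⟨hza, hz⟩, rfl⟩
        exact ⟨fun h => hza (hx hz haR h), z, hz, rfl⟩
      · rintro ⟨hc, z, hz, rfl⟩
        exact ⟨z, ⟨fun h => hc (by rw [h]), hz⟩, rfl⟩
    rw [him]
    simp only [eval_sub, eval_X, eval_C]
    rw [← prod_union]
    · congr 1
      ext c
      have : x a ∈ R.image x := mem_image_of_mem x haR
      simp only [mem_union, mem_sdiff, mem_univ, true_and, mem_erase, and_true]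
      by_cases hc : c = x a
      · subst hc; simp [this]
      · tauto
    · rw [disjoint_left]
      intro c hc hc'
      exact (mem_sdiff.1 hc).2 (mem_of_mem_erase hc')
  rw [sum_congr rfl fun a ha => by rw [hev a ha, mul_assoc], ← mul_sum] at h
  exact (mul_eq_zero.1 h).resolve_left hκ0

end Interpolation

/-! ### The identity for points on a projective line -/

section Pluecker

variable {F ι : Type*} [Field F] [DecidableEq ι]

theorem pluecker_of_alternating {V : Type*} [AddCommGroup V] [Module F V]
    (B : V →ₗ[F] V →ₗ[F] F) (hB : ∀ x, B x x = 0) {w e : V}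
    (hsep : ∀ y, B y w = 0 → B y e = 0 → B y = 0) (z a : V) :
    B w e * B z a = B w z * B e a - B w a * B e z := by
  have hskew : ∀ x y, B x y = -B y x := fun x y => by
    have := hB (x + y)
    simp only [map_add, LinearMap.add_apply, hB, zero_add, add_zero] at this
    exact eq_neg_of_add_eq_zero_right this
  -- This is the linear dependency of z, w, e modulo the radical of B.
  have hu := hsep (B w e • z + B e z • w + B z w • e)
    (by simp [hB, hskew e w, hskew z w]; ring) (by simp [hB, hskew e z]; ring)
  have := LinearMap.congr_fun hu a
  simp only [map_add, map_smul, LinearMap.add_apply, LinearMap.smul_apply, smul_eq_mul,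
    LinearMap.zero_apply, hskew z w] at this
  linear_combination this

theorem prod_erase_mul_of_pluecker {B : ι → ι → F} {w e : ι} {S : Finset ι} (hβ : B w e ≠ 0)
    (hφ : ∀ z ∈ S, B w z ≠ 0)
    (hp : ∀ z a, B w e * B z a = B w z * B e a - B w a * B e z) {a : ι} (ha : a ∈ S) :
    (∏ z ∈ S.erase a, B z a) * B w a = ((B w e)⁻¹ * B w a) ^ (#S - 1) * (∏ z ∈ S, B w z) *
      ∏ z ∈ S.erase a, (B e a / B w a - B e z / B w z) := by
  have h : ∀ z ∈ S.erase a, B z a =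
      ((B w e)⁻¹ * B w a) * B w z * (B e a / B w a - B e z / B w z) := by
    intro z hz
    have h1 := hφ z (mem_of_mem_erase hz)
    have h2 := hφ a ha
    field_simp
    linear_combination hp z a
  rw [prod_congr rfl h, prod_mul_distrib, prod_mul_distrib, prod_const, card_erase_of_mem ha,
    ← mul_prod_erase S _ ha]
  ring

variable [Fintype F]

theorem sum_inv_prod_mul_inv_prod_eq_zero {B : ι → ι → F} {E R : Finset ι} (hER : E ⊆ R) {w : ι}
    (hwR : w ∈ R) (hwE : w ∉ E) (hcard : #E + #R = Fintype.card F + 3)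
    (hB : ∀ z ∈ R, ∀ a ∈ R, z ≠ a → B z a ≠ 0)
    (hp : ∀ e ∈ R, e ≠ w → ∀ z a, B w e * B z a = B w z * B e a - B w a * B e z) :
    ∑ a ∈ E, (∏ z ∈ R.erase a, B z a)⁻¹ * (∏ z ∈ E.erase a, B z a)⁻¹ = 0 := by
  classical
  obtain rfl | ⟨e, he⟩ := E.eq_empty_or_nonempty
  · simp
  have hew : e ≠ w := fun h => hwE (h ▸ he)
  replace hp := hp e (hER he) hew
  have hβ := hB w hwR e (hER he) hew.symm
  set R' := R.erase w with hR'
  have hER' : E ⊆ R' := fun z hz => mem_erase.2 ⟨fun h => hwE (h ▸ hz), hER hz⟩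
  have hφ : ∀ z ∈ R', B w z ≠ 0 := fun z hz =>
    hB w hwR z (mem_of_mem_erase hz) (ne_of_mem_erase hz).symm
  have hR'c : #R' + 1 = #R := card_erase_add_one hwR
  -- Affine coordinate on the line, with w at infinity.
  set x : ι → F := fun z => B e z / B w z with hxdef
  have hx : Set.InjOn x R' := by
    intro z hz a ha h
    by_contra hza
    refine hB z (mem_of_mem_erase hz) a (mem_of_mem_erase ha) hza ?_
    have h1 := hφ z hz
    have h2 := hφ a ha
    simp only [hxdef] at h
    rw [div_eq_div_iff h1 h2] at h
    refine (mul_eq_zero.1 ?_).resolve_left hβ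
    rw [hp]; linear_combination -h
  have key := sum_prod_inv_mul_prod_inv_eq_zero hER' hx (by omega)
  have hEpos : 0 < #E := card_pos.2 ⟨e, he⟩
  have hR'pos : 0 < #R' := card_pos.2 ⟨e, hER' he⟩
  have hterm : ∀ a ∈ E, (∏ z ∈ R.erase a, B z a)⁻¹ * (∏ z ∈ E.erase a, B z a)⁻¹ =
      ((B w e)⁻¹ * (∏ z ∈ R', B w z) * ∏ z ∈ E, B w z)⁻¹ *
        ((∏ z ∈ R'.erase a, (x a - x z))⁻¹ * (∏ z ∈ E.erase a, (x a - x z))⁻¹) := by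
    intro a ha
    have h1 := prod_erase_mul_of_pluecker hβ hφ hp (hER' ha)
    have h2 := prod_erase_mul_of_pluecker hβ (fun z hz => hφ z (hER' hz)) hp ha
    have hw : ∏ z ∈ R.erase a, B z a = B w a * ∏ z ∈ R'.erase a, B z a := by
      rw [hR', erase_right_comm]
      exact (mul_prod_erase _ (fun z => B z a) (mem_erase.2
        ⟨fun h => hwE (by rwa [h]), hwR⟩)).symm
    -- The exponents add up to q, so Frobenius makes the scaling factor independent of a.
    have hpow : ((B w e)⁻¹ * B w a) ^ (#R' - 1) * ((B w e)⁻¹ * B w a) ^ (#E - 1) =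
        (B w e)⁻¹ * B w a := by
      rw [← pow_add, show #R' - 1 + (#E - 1) = Fintype.card F by omega, FiniteField.pow_card]
    have hφa := hφ a (hER' ha)
    rw [← mul_inv, ← mul_inv, ← mul_inv, hw]
    congr 1
    apply mul_right_cancel₀ hφa
    simp only [hxdef]
    linear_combination (∏ z ∈ E.erase a, B z a) * B w a * h1 +
      (((B w e)⁻¹ * B w a) ^ (#R' - 1) * (∏ z ∈ R', B w z) *
        ∏ z ∈ R'.erase a, (B e a / B w a - B e z / B w z)) * h2 +
      ((∏ z ∈ R', B w z) * (∏ z ∈ R'.erase a, (B e a / B w a - B e z / B w z)) *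
        (∏ z ∈ E, B w z) * (∏ z ∈ E.erase a, (B e a / B w a - B e z / B w z))) * hpow
  rw [sum_congr rfl hterm, ← mul_sum, key, mul_zero]

end Pluecker

/-! ### Polarization -/

section Polarization

variable {F ι τ V : Type*} [Field F] [DecidableEq ι] [AddCommGroup V] [Module F V]

/-- A form of degree `m` in the linear functionals `l t` which vanishes on all products of `m`
distinct vectors out of `U` vanishes identically, provided that `U` is in general position
modulo `N`. -/
theorem sum_mul_prod_eq_zero_of_distinct {s : Finset τ} {c : τ → F} {l : τ → V →ₗ[F] F} {v : ι → V}
    {U N : Finset ι} {m : ℕ} (hU : 2 * m ≤ #U) (hN : ∀ t ∈ s, ∀ x ∈ N, l t (v x) = 0)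
    (hspan : ∀ U' ⊆ U, m + 1 ≤ #U' → ∀ f : V →ₗ[F] F, (∀ x ∈ U', f (v x) = 0) →
      (∀ x ∈ N, f (v x) = 0) → f = 0)
    (hbase : ∀ Z ⊆ U, #Z = m → ∑ t ∈ s, c t * ∏ z ∈ Z, l t (v z) = 0)
    (L : List V) {Z : Finset ι} (hZ : Z ⊆ U) (hL : #Z + L.length = m) :
    ∑ t ∈ s, c t * (L.map (l t)).prod * ∏ z ∈ Z, l t (v z) = 0 := by
  induction L generalizing Z with
  | nil => simpa using hbase Z hZ (by simpa using hL)
  | cons y L ih =>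
    simp only [List.length_cons] at hL
    let f : V →ₗ[F] F := ∑ t ∈ s, (c t * (L.map (l t)).prod * ∏ z ∈ Z, l t (v z)) • l t
    -- One slot is freed: f vanishes on N and on U \ Z, which has at least 2m - (m - 1) = m + 1
    -- points.
    have hf : f = 0 := by
      refine hspan (U \ Z) sdiff_subset (by rw [card_sdiff_of_subset hZ]; omega) f ?_ ?_
      · intro u hu
        rw [mem_sdiff] at hu
        have := ih (Z := insert u Z) (insert_subset hu.1 hZ)
          (by rw [card_insert_of_notMem hu.2]; omega)
        rw [← this]
        simp only [f, LinearMap.sum_apply, LinearMap.smul_apply, smul_eq_mul]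
        refine sum_congr rfl fun t _ => ?_
        rw [prod_insert hu.2]
        ring
      · intro x hx
        simp only [f, LinearMap.sum_apply, LinearMap.smul_apply, smul_eq_mul]
        exact sum_eq_zero fun t ht => by rw [hN t ht x hx, mul_zero]
    have := LinearMap.congr_fun hf y
    simp only [f, LinearMap.sum_apply, LinearMap.smul_apply, smul_eq_mul,
      LinearMap.zero_apply] at this
    rw [← this]
    refine sum_congr rfl fun t _ => ?_
    rw [List.map_cons, List.prod_cons]
    ring

end Polarization

/-! ### Hyperplane functionals and weights of an arc -/

section Arc

theorem vecCons_comp {V ι : Type*} {v : ι → V} {n : ℕ} (a : ι) (c : Fin n → ι) :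
    Matrix.vecCons (v a) (v ∘ c) = v ∘ Fin.cons a c := by
  funext i
  refine Fin.cases ?_ (fun j => ?_) i <;> simp

variable {F V ι : Type*} [Field F] [AddCommGroup V] [Module F V] {r : ℕ}

/-- The linear functional with kernel spanned by the vectors indexed by the `(r + 1)`-set `C`,
well defined up to sign. -/
noncomputable def wallFunctional (dt : V [⋀^Fin (r + 2)]→ₗ[F] F) (v : ι → V) (C : Finset ι) : V →ₗ[F] F :=
  if h : #C = r + 1 then
    { toFun := fun z => dt.curryLeft z fun i => v ((C.equivFinOfCardEq h).symm i)
      map_add' := fun x y => by simp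
      map_smul' := fun a x => by simp }
  else 0

variable [DecidableEq ι] {dt : V [⋀^Fin (r + 2)]→ₗ[F] F} {v : ι → V}

theorem exists_sign_wallFunctional {c : Fin (r + 1) → ι} (hc : c.Injective) {C : Finset ι}
    (hC : univ.image c = C) :
    ∃ ε : F, ε ^ 2 = 1 ∧ ∀ z, wallFunctional dt v C z = ε * dt.curryLeft z (v ∘ c) := by
  have hcard : #C = r + 1 := by rw [← hC, card_image_of_injective _ hc]; simp
  have hcC : ∀ i, c i ∈ C := fun i => hC ▸ mem_image_of_mem c (mem_univ i)
  let g : Fin (r + 1) → Fin (r + 1) := fun i => C.equivFinOfCardEq hcard ⟨c i, hcC i⟩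
  have hg : g.Injective := fun i j h => hc (by simpa [g] using h)
  let σ : Equiv.Perm (Fin (r + 1)) := Equiv.ofBijective g (Finite.injective_iff_bijective.1 hg)
  refine ⟨((Equiv.Perm.sign σ : ℤ) : F), ?_, fun z => ?_⟩
  · rcases Int.units_eq_one_or (Equiv.Perm.sign σ) with h | h <;> simp [h]
  · have hvc : v ∘ c = (fun i => v ((C.equivFinOfCardEq hcard).symm i)) ∘ σ := by
      funext i
      simp [σ, g]
    rw [hvc, AlternatingMap.map_perm]
    simp only [wallFunctional, dif_pos hcard]
    rcases Int.units_eq_one_or (Equiv.Perm.sign σ) with h | h <;> simp [h]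

theorem exists_enum {n : ℕ} {C : Finset ι} (h : #C = n) :
    ∃ c : Fin n → ι, c.Injective ∧ univ.image c = C := by
  refine ⟨fun i => (C.equivFinOfCardEq h).symm i, fun i j hij => by simpa using hij, ?_⟩
  ext x
  simp only [mem_image, mem_univ, true_and]
  constructor
  · rintro ⟨i, rfl⟩; exact coe_mem _
  · intro hx; exact ⟨C.equivFinOfCardEq h ⟨x, hx⟩, by simp⟩

theorem wallFunctional_eq_zero {C : Finset ι} (h : #C = r + 1) {x : ι} (hx : x ∈ C) :
    wallFunctional dt v C (v x) = 0 := by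
  obtain ⟨c, hc, hcC⟩ := exists_enum h
  obtain ⟨ε, -, hε⟩ := exists_sign_wallFunctional (dt := dt) (v := v) hc hcC
  obtain ⟨i, -, rfl⟩ := mem_image.1 (hcC ▸ hx)
  rw [hε, AlternatingMap.curryLeft_apply_apply,
    dt.map_eq_zero_of_eq (i := 0) (j := i.succ) _ (by simp) (Fin.succ_ne_zero i).symm, mul_zero]

theorem wallFunctional_ne_zero
    (hdt : ∀ c : Fin (r + 2) → ι, c.Injective → dt (v ∘ c) ≠ 0)
    {C : Finset ι} (h : #C = r + 1) {x : ι} (hx : x ∉ C) :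
    wallFunctional dt v C (v x) ≠ 0 := by
  obtain ⟨c, hc, hcC⟩ := exists_enum h
  obtain ⟨ε, hε1, hε⟩ := exists_sign_wallFunctional (dt := dt) (v := v) hc hcC
  rw [hε, AlternatingMap.curryLeft_apply_apply, vecCons_comp]
  refine mul_ne_zero (fun h0 => by simp [h0] at hε1) (hdt _ (Fin.cons_injective_iff.2 ⟨?_, hc⟩))
  rintro ⟨i, rfl⟩
  exact hx (hcC ▸ mem_image_of_mem c (mem_univ i))

variable [Fintype ι]

/-- The value at `C` of the vector annihilated by the inclusion matrix of subsets of `E`. -/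
noncomputable def arcWeight (dt : V [⋀^Fin (r + 2)]→ₗ[F] F) (v : ι → V) (E C : Finset ι) : F :=
  (∏ z ∈ univ \ C, wallFunctional dt v C (v z))⁻¹ * (∏ z ∈ E \ C, wallFunctional dt v C (v z))⁻¹

theorem arcWeight_ne_zero (hdt : ∀ c : Fin (r + 2) → ι, c.Injective → dt (v ∘ c) ≠ 0)
    {C : Finset ι} (h : #C = r + 1) (E : Finset ι) : arcWeight dt v E C ≠ 0 := by
  refine mul_ne_zero (inv_ne_zero ?_) (inv_ne_zero ?_) <;>
  exact prod_ne_zero_iff.2 fun z hz => wallFunctional_ne_zero hdt h (mem_sdiff.1 hz).2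

theorem arcWeight_sdiff (hdt : ∀ c : Fin (r + 2) → ι, c.Injective → dt (v ∘ c) ≠ 0)
    {C : Finset ι} (h : #C = r + 1) {E Z : Finset ι} (hZ : Z ⊆ E) (hZC : Disjoint Z C) :
    arcWeight dt v (E \ Z) C =
      arcWeight dt v E C * ∏ z ∈ Z, wallFunctional dt v C (v z) := by
  have hne : ∏ z ∈ Z, wallFunctional dt v C (v z) ≠ 0 := prod_ne_zero_iff.2 fun z hz =>
    wallFunctional_ne_zero hdt h (disjoint_left.1 hZC hz)
  have hsub : Z ⊆ E \ C := fun z hz => mem_sdiff.2 ⟨hZ hz, disjoint_left.1 hZC hz⟩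
  rw [arcWeight, arcWeight, ← prod_sdiff hsub, sdiff_right_comm]
  field_simp

variable [Fintype F]

/-- The sign from the ordering of C occurs q + 1 times in all, and ε ^ (q + 1) = ε ^ 2 = 1. -/
theorem arcWeight_eq (hcard : Fintype.card ι = Fintype.card F + 2)
    {c : Fin (r + 1) → ι} (hc : c.Injective) {C E : Finset ι} (hC : univ.image c = C)
    (hCE : C ⊆ E) (hE : #E = 2 * r + 1) :
    arcWeight dt v E C = (∏ z ∈ univ \ C, dt.curryLeft (v z) (v ∘ c))⁻¹ *
      (∏ z ∈ E \ C, dt.curryLeft (v z) (v ∘ c))⁻¹ := by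
  obtain ⟨ε, hε1, hε⟩ := exists_sign_wallFunctional (dt := dt) (v := v) hc hC
  have hCc : #C = r + 1 := by rw [← hC, card_image_of_injective _ hc]; simp
  have hEu : #E ≤ Fintype.card ι := card_le_univ _
  have hpow : ε ^ #(univ \ C) * ε ^ #(E \ C) = 1 := by
    rw [← pow_add, card_sdiff_of_subset (subset_univ _), card_sdiff_of_subset hCE, card_univ, hE,
      hCc, hcard]
    have := card_le_card hCE
    rw [show Fintype.card F + 2 - (r + 1) + (2 * r + 1 - (r + 1)) = Fintype.card F + 1 by omega,
      pow_succ, FiniteField.pow_card, ← pow_two, hε1]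
  simp only [arcWeight, hε, prod_mul_distrib, prod_const]
  rw [← mul_inv, ← mul_inv]
  congr 1
  linear_combination (∏ z ∈ univ \ C, dt.curryLeft (v z) (v ∘ c)) *
      (∏ z ∈ E \ C, dt.curryLeft (v z) (v ∘ c)) * hpow

theorem isInclusionNull_arcWeight (hcard : Fintype.card ι = Fintype.card F + 2)
    (hdt : ∀ c : Fin (r + 2) → ι, c.Injective → dt (v ∘ c) ≠ 0)
    (hsep : ∀ B : Finset ι, #B = r + 2 → ∀ f : V →ₗ[F] F, (∀ x ∈ B, f (v x) = 0) → f = 0)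
    {E : Finset ι} (hE : #E = 2 * r + 1) (hEι : #E < Fintype.card ι) :
    IsInclusionNull (arcWeight dt v E) E r := by
  intro A hA hAr
  obtain ⟨s, hs, hsA⟩ := exists_enum hAr
  obtain ⟨w, hw⟩ : ∃ w, w ∉ E := by
    by_contra! h
    exact hEι.ne (by rw [eq_univ_of_forall h, card_univ])
  -- Fixing the r points of A projects the arc from their span to a line.
  let B : V →ₗ[F] V →ₗ[F] F := LinearMap.mk₂ F (fun z a => (dt.curryLeft z).curryLeft a (v ∘ s))
    (by simp) (by simp) (by simp) (by simp)
  have hBdef : ∀ z a, B z a = (dt.curryLeft z).curryLeft a (v ∘ s) := fun _ _ => rfl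
  have hmem : ∀ i, s i ∈ A := fun i => hsA ▸ mem_image_of_mem s (mem_univ i)
  have hnot : ∀ {a}, a ∉ A → a ∉ Set.range s := by
    rintro a ha ⟨i, rfl⟩; exact ha (hmem i)
  have hcons : ∀ {a}, a ∉ A → (Fin.cons a s : Fin (r + 1) → ι).Injective := fun ha =>
    Fin.cons_injective_iff.2 ⟨hnot ha, hs⟩
  have hBA : ∀ y, ∀ x ∈ A, B y (v x) = 0 := by
    intro y x hx
    obtain ⟨i, -, rfl⟩ := mem_image.1 (hsA ▸ hx)
    rw [hBdef, AlternatingMap.curryLeft_apply_apply]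
    exact AlternatingMap.map_eq_zero_of_eq (i := 0) (j := i.succ) _ _ (by simp)
      (Fin.succ_ne_zero i).symm
  have hBne : ∀ z ∈ univ \ A, ∀ a ∈ univ \ A, z ≠ a → B (v z) (v a) ≠ 0 := by
    intro z hz a ha hza
    rw [mem_sdiff] at hz ha
    rw [hBdef, AlternatingMap.curryLeft_apply_apply, vecCons_comp,
      AlternatingMap.curryLeft_apply_apply, vecCons_comp]
    refine hdt _ (Fin.cons_injective_iff.2 ⟨?_, hcons ha.2⟩)
    rintro ⟨i, hi⟩
    refine Fin.cases (fun h => hza (by simpa using h.symm)) (fun j h => hz.2 ?_) i hi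
    rw [← h]; simpa using hmem j
  have hwA : w ∉ A := fun h => hw (hA h)
  have key := sum_inv_prod_mul_inv_prod_eq_zero (B := fun z a => B (v z) (v a)) (E := E \ A)
    (R := univ \ A) (sdiff_subset_sdiff (subset_univ _) le_rfl) (w := w)
    (mem_sdiff.2 ⟨mem_univ _, hwA⟩) (fun h => hw (mem_sdiff.1 h).1)
    (by
      rw [card_sdiff_of_subset (subset_univ _), card_sdiff_of_subset hA, card_univ, hE,
        hAr, hcard]
      have := card_le_card hA
      omega)
    hBne (fun e he hew z a => by
      refine pluecker_of_alternating B (fun x => by rw [hBdef, AlternatingMap.curryLeft_same]; rfl)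
        (fun y h1 h2 => hsep (insert w (insert e A)) ?_ _ ?_) _ _
      · rw [card_insert_of_notMem, card_insert_of_notMem (mem_sdiff.1 he).2, hAr]
        simp [hew.symm, hwA]
      · intro x hx
        rcases mem_insert.1 hx with rfl | hx
        · exact h1
        rcases mem_insert.1 hx with rfl | hx
        · exact h2
        exact hBA y x hx)
  rw [← key]
  refine sum_congr rfl fun a ha => ?_
  rw [mem_sdiff] at ha
  rw [arcWeight_eq hcard (hcons ha.2) (C := insert a A) _ (insert_subset ha.1 hA) hE]
  · simp only [hBdef, AlternatingMap.curryLeft_apply_apply, vecCons_comp, sdiff_insert]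
  · ext x
    simp only [mem_image, mem_univ, true_and, Fin.exists_fin_succ, Fin.cons_zero, Fin.cons_succ,
      mem_insert, ← hsA, eq_comm]

end Arc

/-! ### The contradiction in low dimension -/

section Bound

variable {F V ι : Type*} [Field F] [Fintype F] [AddCommGroup V] [Module F V] [Fintype ι]

/-- There is no arc of size `q + 2` in dimension `r + 2 = m + d + 2` if `m ≤ d` and `d + 1` is less
than the characteristic. -/
theorem false_of_arc_card_eq_add_two {r m d : ℕ} (hr : r = m + d) (hmd : m ≤ d)
    (hd : ∀ i ≤ d, ((i + 1 : ℕ) : F) ≠ 0)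
    (dt : V [⋀^Fin (r + 2)]→ₗ[F] F) (v : ι → V)
    (hcard : Fintype.card ι = Fintype.card F + 2)
    (h1 : 2 * r + 1 < Fintype.card ι) (h2 : 2 * r + 1 + m ≤ Fintype.card ι)
    (hdt : ∀ c : Fin (r + 2) → ι, c.Injective → dt (v ∘ c) ≠ 0)
    (hsep : ∀ B : Finset ι, #B = r + 2 → ∀ f : V →ₗ[F] F, (∀ x ∈ B, f (v x) = 0) → f = 0) :
    False := by
  classical
  -- The reservoir `U` has d + m ≥ 2m points, as polarization needs; removing m of them from `E`
  -- leaves 2r + 1.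
  obtain ⟨g⟩ : Nonempty (Fin m ⊕ Fin m ⊕ Fin (d + 1) ⊕ Fin (d + m) ↪ ι) :=
    Function.Embedding.nonempty_of_card_le (by simp; omega)
  set a : Fin m → ι := fun i => g (.inl i) with ha
  set b : Fin m → ι := fun i => g (.inr (.inl i)) with hb
  set D : Finset ι := univ.image fun i => g (.inr (.inr (.inl i))) with hD
  set U : Finset ι := univ.image fun i => g (.inr (.inr (.inr i))) with hU
  have hDc : #D = d + 1 := by
    rw [hD, card_image_of_injective _ fun i j h => by simpa using h]; simp
  have hUc : #U = d + m := by
    rw [hU, card_image_of_injective _ fun i j h => by simpa using h]; simp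
  have hainj : a.Injective := fun i j h => by simpa [ha] using h
  have hbinj : b.Injective := fun i j h => by simpa [hb] using h
  have hab : ∀ i j, a i ≠ b j := fun i j => by simp [ha, hb]
  have haD : ∀ i, a i ∉ D := fun i => by simp [ha, hD]
  have hbD : ∀ i, b i ∉ D := fun i => by simp [hb, hD]
  have haU : ∀ i, a i ∉ U := fun i => by simp [ha, hU]
  have hbU : ∀ i, b i ∉ U := fun i => by simp [hb, hU]
  have hDU : Disjoint D U := by
    rw [disjoint_left]
    intro x hx hx'
    obtain ⟨i, -, rfl⟩ := mem_image.1 hx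
    simp [hU] at hx'
  clear_value a b D U
  set E : Finset ι := univ.image a ∪ univ.image b ∪ D ∪ U with hE
  set C : Finset (Fin m) → Finset ι := fun T => (univ \ T).image a ∪ T.image b ∪ D with hC
  have hEc : #E = 2 * m + (d + 1) + (d + m) := by
    rw [hE, card_union_of_disjoint, card_union_of_disjoint, card_union_of_disjoint,
      card_image_of_injective _ hainj, card_image_of_injective _ hbinj, hDc, hUc, card_univ,
      Fintype.card_fin]
    · omega
    · rw [disjoint_left]
      intro x hx hx'
      obtain ⟨i, -, rfl⟩ := mem_image.1 hx
      obtain ⟨j, -, h⟩ := mem_image.1 hx'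
      exact hab i j h.symm
    · rw [disjoint_left]
      intro x hx hx'
      rcases mem_union.1 hx with hx | hx
      · obtain ⟨i, -, rfl⟩ := mem_image.1 hx; exact haD i hx'
      · obtain ⟨i, -, rfl⟩ := mem_image.1 hx; exact hbD i hx'
    · rw [disjoint_left]
      intro x hx hx'
      rcases mem_union.1 hx with hx | hx
      · rcases mem_union.1 hx with hx | hx
        · obtain ⟨i, -, rfl⟩ := mem_image.1 hx; exact haU i hx'
        · obtain ⟨i, -, rfl⟩ := mem_image.1 hx; exact hbU i hx'
      · exact disjoint_left.1 hDU hx hx'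
  have hCc : ∀ T, #(C T) = r + 1 := by
    intro T
    have hT : #T ≤ m := by simpa using card_le_univ T
    rw [hC]
    dsimp only
    rw [card_union_of_disjoint, card_union_of_disjoint,
      card_image_of_injective _ hainj, card_image_of_injective _ hbinj, hDc,
      card_sdiff_of_subset (subset_univ _), card_univ, Fintype.card_fin]
    · omega
    · rw [disjoint_left]
      intro x hx hx'
      obtain ⟨i, -, rfl⟩ := mem_image.1 hx
      obtain ⟨j, -, h⟩ := mem_image.1 hx'
      exact hab i j h.symm
    · rw [disjoint_left]
      intro x hx hx'
      rcases mem_union.1 hx with hx | hx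
      · obtain ⟨i, -, rfl⟩ := mem_image.1 hx; exact haD i hx'
      · obtain ⟨i, -, rfl⟩ := mem_image.1 hx; exact hbD i hx'
  have hCU : ∀ T, ∀ x ∈ U, x ∉ C T := by
    intro T x hx hxC
    rcases mem_union.1 hxC with h | h
    · rcases mem_union.1 h with h | h
      · obtain ⟨i, -, rfl⟩ := mem_image.1 h; exact haU i hx
      · obtain ⟨i, -, rfl⟩ := mem_image.1 h; exact hbU i hx
    · exact disjoint_left.1 hDU h hx
  have hUE : U ⊆ E := subset_union_right
  have hbase : ∀ Z ⊆ U, #Z = m → ∑ T ∈ (univ : Finset (Fin m)).powerset,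
      ((-1) ^ #T * arcWeight dt v E (C T)) *
        ∏ z ∈ Z, wallFunctional dt v (C T) (v z) = 0 := by
    intro Z hZ hZc
    have hEZ : #(E \ Z) = 2 * r + 1 := by
      rw [card_sdiff_of_subset (hZ.trans hUE), hEc, hZc]; omega
    have hnull := isInclusionNull_arcWeight hcard hdt hsep hEZ (by omega)
    have hnull' : IsInclusionNull (arcWeight dt v (E \ Z)) (E \ Z)
        (#(univ : Finset (Fin m)) + d) := by
      convert hnull
      simpa using hr.symm
    have := hnull'.sum_transversal_eq_zero hainj hbinj hab hd univ
      (by simp; omega)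
      (fun j _ => mem_sdiff.2 ⟨by simp [hE], fun h => haU j (hZ h)⟩)
      (fun j _ => mem_sdiff.2 ⟨by simp [hE], fun h => hbU j (hZ h)⟩)
      (X := D) (fun x hx => mem_sdiff.2 ⟨by simp [hE, hx],
        fun h => disjoint_left.1 hDU hx (hZ h)⟩) hDc (fun j _ => haD j) (fun j _ => hbD j)
    rw [← this]
    refine sum_congr rfl fun T _ => ?_
    change _ = (-1) ^ #T * arcWeight dt v (E \ Z) (C T)
    rw [arcWeight_sdiff hdt (hCc T) (hZ.trans hUE)
      (disjoint_left.2 fun z hz => hCU T z (hZ hz))]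
    ring
  have hfin := sum_mul_prod_eq_zero_of_distinct (v := v) (N := D)
    (l := fun T => wallFunctional dt v (C T)) (by omega : 2 * m ≤ #U)
    (fun T _ x hx => wallFunctional_eq_zero (hCc T) (mem_union_right _ hx))
    (fun U' hU' hU'c f hf hfD => by
      obtain ⟨U'', hU'', hU''c⟩ := exists_subset_card_eq hU'c
      refine hsep (D ∪ U'') ?_ f fun x hx => ?_
      · rw [card_union_of_disjoint (hDU.mono_right (hU''.trans hU')), hDc, hU''c]; omega
      · exact (mem_union.1 hx).elim (hfD x) fun h => hf x (hU'' h))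
    hbase (List.ofFn fun i => v (b i)) (Z := ∅) (empty_subset _) (by simp)
  simp only [prod_empty, mul_one, List.map_ofFn, List.prod_ofFn, Function.comp_apply] at hfin
  -- If j ∈ T then b j lies on the hyperplane of `C T`, so that term dies.
  rw [sum_eq_single_of_mem ∅ (empty_mem_powerset _)] at hfin
  · refine mul_ne_zero (mul_ne_zero (by simp) (arcWeight_ne_zero hdt (hCc ∅) E))
      (prod_ne_zero_iff.2 fun i _ => wallFunctional_ne_zero hdt (hCc ∅) ?_) hfin
    simp [hC, hab, hbD]
  · intro T _ hT
    obtain ⟨j, hj⟩ := nonempty_iff_ne_empty.2 hT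
    rw [prod_eq_zero (mem_univ j), mul_zero]
    refine wallFunctional_eq_zero (hCc T) ?_
    exact mem_union_left _ (mem_union_right _ (mem_image_of_mem b hj))

end Bound

/-! ### Duality of arcs -/

section Dual

universe u

variable {F : Type u} [Field F]

/-- The separation property of a family in a space of the right dimension gives a determinant. -/
theorem exists_alternating_ne_zero {V ι : Type*} [AddCommGroup V] [Module F V]
    [FiniteDimensional F V] {n : ℕ} (hV : Module.finrank F V = n) {v : ι → V}
    (hsep : ∀ B : Finset ι, #B = n → ∀ f : V →ₗ[F] F, (∀ x ∈ B, f (v x) = 0) → f = 0) :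
    ∃ dt : V [⋀^Fin n]→ₗ[F] F, ∀ c : Fin n → ι, c.Injective → dt (v ∘ c) ≠ 0 := by
  classical
  let e := Module.finBasisOfFinrankEq F V hV
  refine ⟨e.det, fun c hc => ?_⟩
  have hspan : Submodule.span F (Set.range (v ∘ c)) = ⊤ := by
    by_contra h
    obtain ⟨f, hf, hle⟩ := Submodule.exists_le_ker_of_lt_top _ (lt_top_iff_ne_top.2 h)
    refine hf (hsep (univ.image c) (by simp [card_image_of_injective _ hc]) f fun x hx => ?_)
    obtain ⟨i, -, rfl⟩ := mem_image.1 hx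
    exact hle (Submodule.subset_span ⟨i, rfl⟩)
  have hli := linearIndependent_of_top_le_span_of_card_eq_finrank hspan.ge (by simp [hV])
  exact ((Module.Basis.is_basis_iff_det e).1 ⟨hli, hspan⟩).ne_zero

/-- The dual of an arc of size `n` in dimension `k` is an arc of size `n` in
dimension `n - k`. -/
theorem EverySubsetIsBasis.exists_dual {k : ℕ} {S : Finset (Fin k → F)}
    (hS : EverySubsetIsBasis F k S) {n : ℕ} (hn : #S = n + k) :
    ∃ (V : Type u) (_ : AddCommGroup V) (_ : Module F V) (_ : FiniteDimensional F V) (v : S → V),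
      Module.finrank F V = n ∧
      ∀ B : Finset S, #B = n → ∀ f : V →ₗ[F] F, (∀ x ∈ B, f (v x) = 0) → f = 0 := by
  classical
  let φ : (S → F) →ₗ[F] (Fin k → F) := Fintype.linearCombination F fun x : S => (x : Fin k → F)
  -- The dual arc consists of the coordinate functionals on the space of relations. A relation
  -- vanishing on n coordinates involves only k vectors, which are independent.
  let K := LinearMap.ker φ
  have hφ : LinearMap.range φ = ⊤ := by
    obtain ⟨B, hB, hBc⟩ := exists_subset_card_eq (show k ≤ #S by omega)
    rw [Fintype.range_linearCombination, eq_top_iff, ← (hS B hB hBc).2]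
    exact Submodule.span_mono fun x hx => ⟨⟨x, hB hx⟩, rfl⟩
  have hK : Module.finrank F K = n := by
    have := φ.finrank_range_add_finrank_ker
    rw [hφ, finrank_top] at this
    simp only [Module.finrank_fintype_fun_eq_card, Fintype.card_fin, Fintype.card_coe, hn] at this
    change Module.finrank F (LinearMap.ker φ) = n
    omega
  refine ⟨Module.Dual F K, inferInstance, inferInstance, inferInstance,
    fun i => (LinearMap.proj i).comp K.subtype, by rw [Subspace.dual_finrank_eq, hK], ?_⟩
  intro B hB f hf
  obtain ⟨x, rfl⟩ := (Module.evalEquiv F K).surjective f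
  have hx0 : ∀ i ∈ B, (x : S → F) i = 0 := fun i hi => by simpa using hf i hi
  suffices x = 0 by rw [this, map_zero]
  have hxK : ∑ i : S, (x : S → F) i • (i : Fin k → F) = 0 := by
    have := x.2
    rwa [LinearMap.mem_ker, Fintype.linearCombination_apply] at this
  have hsum : ∑ i ∈ Bᶜ, (x : S → F) i • (i : Fin k → F) = 0 := by
    rw [← hxK]
    refine sum_subset (subset_univ _) fun i _ hi => ?_
    rw [hx0 i (by simpa using hi), zero_smul]
  have hli : LinearIndepOn F id ((Bᶜ.map (Function.Embedding.subtype _) : Finset (Fin k → F)) :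
      Set (Fin k → F)) :=
    (hS (Bᶜ.map (Function.Embedding.subtype _)) (fun y hy => by
      obtain ⟨i, -, rfl⟩ := mem_map.1 hy; exact i.2)
      (by rw [card_map, card_compl, Fintype.card_coe, hn, hB]; omega)).1
  have hli' := linearIndepOn_finset_iff.1 hli
    (fun y => if h : y ∈ S then (x : S → F) ⟨y, h⟩ else 0)
    (by rw [sum_map, ← hsum]; exact sum_congr rfl fun i _ => by simp)
  ext i
  by_cases hi : i ∈ B
  · exact hx0 i hi
  · simpa using hli' i (mem_map.2 ⟨i, mem_compl.2 hi, rfl⟩)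

end Dual

theorem mainTheorem3 (p h q : ℕ) (hp : p.Prime) (hq : q = p ^ h) (hq' : ¬ q.Prime)
    (F : Type*) [Field F] [Fintype F] (hF : Fintype.card F = q)
    (k : ℕ) (hk₁ : (q : ℤ) - 2 * p + 4 ≤ k) (hk₂ : k ≤ q)
    (S : Finset (Fin k → F)) (hS : EverySubsetIsBasis F k S) :
    S.card ≤ q + 1 := by
  by_contra! hlt
  have hh : 2 ≤ h := by
    have hq1 : 1 < q := hF ▸ Fintype.one_lt_card
    rcases h with _ | _ | h
    · simp [hq] at hq1
    · exact absurd hp (by simpa [hq] using hq')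
    · omega
  have hpq : p * p ≤ q := by
    rw [hq, ← pow_two]; exact Nat.pow_le_pow_right hp.pos hh
  -- This is (p - 2)(p - 3) ≥ 0; with p² ≤ q it leaves room for the 2r + 1 + m points.
  have hp5 : 5 * p ≤ p * p + 6 := by
    have := hp.two_le
    rcases Nat.lt_or_ge p 5 with h5 | h5
    · interval_cases p <;> omega
    · nlinarith
  have := Fact.mk hp
  have hchar : CharP F p := charP_of_card_eq_prime_pow (hF.trans hq)
  obtain ⟨S', hS'S, hS'c⟩ := exists_subset_card_eq (show q + 2 ≤ #S by omega)
  have hS' : EverySubsetIsBasis F k S' := fun B hB => hS B (hB.trans hS'S)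
  obtain ⟨r, hr⟩ : ∃ r, q = k + r := ⟨q - k, by omega⟩
  obtain ⟨V, _, _, _, v, hV, hsep⟩ := hS'.exists_dual (n := r + 2) (by omega)
  obtain ⟨dt, hdt⟩ := exists_alternating_ne_zero hV hsep
  have hcard : Fintype.card S' = Fintype.card F + 2 := by rw [Fintype.card_coe, hF, hS'c]
  have hp2 := hp.two_le
  -- The balanced split gives d ≤ p - 2 exactly because r ≤ 2p - 4.
  refine false_of_arc_card_eq_add_two (r := r) (m := r / 2) (d := r - r / 2) (by omega) (by omega)
    (fun i hi h0 => ?_) dt v hcard (by omega) (by omega) hdt hsep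
  have := Nat.le_of_dvd (by omega) ((CharP.cast_eq_zero_iff F p _).1 h0)
  omega
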